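/- Let $n,r\ge 0$ be integers with $n\ge 2r$, let $s\in\mathbb C$, and let $\lambda=(\lambda_1\ge\dots\ge\lambda_r\ge 0)$ be a partition with at most $r$ parts, identified with its Young diagram of boxes $\mathfrak b=(i,j)$, $1\le j\le\lambda_i$. For a box $\mathfrak b=(i,j)$ of a partition $\mu$ put $a_\mu(\mathfrak b)=\mu_i-j$, $l_\mu(\mathfrak b)=|\{k>i:\mu_k\ge j\}|$, $a'_\mu(\mathfrak b)=j-1$, $l'_\mu(\mathfrak b)=i-1$, and $$b_\mu(\mathfrak b;\tau)=\frac{a_\mu(\mathfrak b)+\tau(l_\mu(\mathfrak b)+1)}{a_\mu(\mathfrak b)+\tau l_\mu(\mathfrak b)+1}.$$ A reverse tableau $T$ of shape $\lambda$ is a filling of the boxes of $\lambda$ with entries in $\{1,\dots,r\}$ that is weakly decreasing along rows and strictly decreasing down columns; $\lambda^{(k)}\subseteq\lambda$ is the partition formed by the boxes with $T(\mathfrak b)>k$. For $\nu\subseteq\mu$ let $(R\backslash C)_{\mu\backslash\nu}$ be the set of boxes of $\mu$ that lie in a row meeting $\mu\backslash\nu$ but not in a column meeting $\mu\backslash\nu$,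 and put $$\Phi_T(\tau)=\prod_{i=1}^{r}\ \prod_{\mathfrak b\in (R\backslash C)_{\lambda^{(i-1)}\backslash\lambda^{(i)}}}\frac{b_{\lambda^{(i)}}(\mathfrak b;\tau)}{b_{\lambda^{(i-1)}}(\mathfrak b;\tau)}.$$ The Okounkov polynomial of type $BC_r$ is $$P_\lambda(x;\tau;\alpha)=\sum_T\Phi_T(\tau)\prod_{\mathfrak b\in\lambda}\Big(x_{T(\mathfrak b)}^2-\big(a'_\lambda(\mathfrak b)+\tau(r-T(\mathfrak b)-l'_\lambda(\mathfrak b))+\alpha\big)^2\Big),$$ the sum being over all reverse tableaux $T$ of shape $\lambda$ with entries in $\{1,\dots,r\}$. Let $\rho=(\rho_1,\dots,\rho_r)$ with $\rho_i=\frac{n-(2i-1)}{2}$. Let $HSP_\lambda$ be the homogeneous part of highest degree of $P_\lambda\big(x+\rho;\,1;\,s-\tfrac{n-1}{2}\big)$, regarded as a polynomial in $x=(x_1,\dots,x_r)$ over $\mathbb C$. Let $s_\lambda(x_1,\dots,x_r)$ be the Schur polynomial, i.e. the sum of the monomials $\prod_{\mathfrak b\in\lambda}x_{S(\mathfrak b)}$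 over all semistandard tableaux $S$ of shape $\lambda$ with entries in $\{1,\dots,r\}$. Then $$HSP_\lambda(x_1,\dots,x_r)=s_\lambda(x_1^2,\dots,x_r^2).$$ Moreover, for a partition $\mu=(\mu_1,\dots,\mu_l)$ with parts $\mu_i>0$ let $p_\mu=\prod_{i=1}^{l}\big(x_1^{\mu_i}+\dots+x_r^{\mu_i}\big)$ (with $p_\emptyset=1$) and $2\mu=(2\mu_1,\dots,2\mu_l)$. If $s_\lambda(x_1,\dots,x_r)=\sum_\mu a_\mu p_\mu$ is any expression of $s_\lambda$ as a finite linear combination of power sum products with complex coefficients $a_\mu$, then $$HSP_\lambda=\sum_\mu a_\mu\,p_{2\mu}.$$ -/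

import Mathlib

open MvPolynomial

noncomputable section

/-! Partitions are Young diagrams. Boxes are pairs `(row, column)` counted from `0`, so that the box
`(i, j)` below is the box `(i + 1, j + 1)` of the usual English notation. Likewise an element `t` of
`Fin r` stands for the entry (or the index of the variable) `t + 1` of `{1, …, r}`. -/

namespace Okounkov

/-- Arm length `μ_i - j` of the box `c` of `μ`. -/
def arm (μ : YoungDiagram) (c : ℕ × ℕ) : ℕ := μ.rowLen c.1 - (c.2 + 1)

/-- Leg length of the box `c` of `μ`: the number of boxes of `μ` strictly below `c`. -/
def leg (μ : YoungDiagram) (c : ℕ × ℕ) : ℕ := μ.colLen c.2 - (c.1 + 1)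

/-- Reverse tableaux of shape `lam` with entries in `{1, …, r}`: rows weakly decreasing,
columns strictly decreasing. -/
@[ext]
structure ReverseTableau (lam : YoungDiagram) (r : ℕ) where
  entry : lam.cells → Fin r
  row_weak : ∀ c d : lam.cells, c.1.1 = d.1.1 → c.1.2 < d.1.2 → entry d ≤ entry c
  col_strict : ∀ c d : lam.cells, c.1.2 = d.1.2 → c.1.1 < d.1.1 → entry d < entry c

instance (lam : YoungDiagram) (r : ℕ) : Finite (ReverseTableau lam r) :=
  Finite.of_injective ReverseTableau.entry fun _ _ h => ReverseTableau.ext h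

instance (lam : YoungDiagram) (r : ℕ) : Fintype (ReverseTableau lam r) := Fintype.ofFinite _

/-- The entries of a reverse tableau weakly decrease towards the lower right. -/
theorem ReverseTableau.entry_anti {lam : YoungDiagram} {r : ℕ} (T : ReverseTableau lam r)
    (c d : lam.cells) (h : c.1 ≤ d.1) : T.entry d ≤ T.entry c := by
  obtain ⟨⟨i, j⟩, hc⟩ := c
  obtain ⟨⟨i', j'⟩, hd⟩ := d
  obtain ⟨hi, hj⟩ : i ≤ i' ∧ j ≤ j' := h
  have he : (i, j') ∈ lam.cells := lam.up_left_mem hi le_rfl hd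
  have h1 : T.entry ⟨(i', j'), hd⟩ ≤ T.entry ⟨(i, j'), he⟩ := by
    rcases hi.eq_or_lt with rfl | hi
    · exact le_rfl
    · exact (T.col_strict ⟨(i, j'), he⟩ ⟨(i', j'), hd⟩ rfl hi).le
  have h2 : T.entry ⟨(i, j'), he⟩ ≤ T.entry ⟨(i, j), hc⟩ := by
    rcases hj.eq_or_lt with rfl | hj
    · exact le_rfl
    · exact T.row_weak ⟨(i, j), hc⟩ ⟨(i, j'), he⟩ rfl hj
  exact h1.trans h2

/-- The partition `λ^(k) ⊆ λ` formed by the boxes whose entry in `{1, …, r}` is `> k`. -/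
def ReverseTableau.sub {lam : YoungDiagram} {r : ℕ} (T : ReverseTableau lam r) (k : ℕ) :
    YoungDiagram where
  cells := {c ∈ lam.cells | ∃ h : c ∈ lam.cells, k < (T.entry ⟨c, h⟩ : ℕ) + 1}
  isLowerSet := by
    intro d c hcd hd
    simp only [Finset.coe_filter, Set.mem_ofPred_eq] at hd ⊢
    obtain ⟨hd, _, hk⟩ := hd
    have hc : c ∈ lam.cells := lam.isLowerSet hcd hd
    have h := T.entry_anti ⟨c, hc⟩ ⟨d, hd⟩ hcd
    exact ⟨hc, hc, lt_of_lt_of_le hk (Nat.succ_le_succ (Fin.le_def.mp h))⟩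

/-- `(R \ C)_{μ \ ν}`: the boxes of `μ` in a row that meets `μ \ ν` but in no column that meets
`μ \ ν`. -/
def rowNotCol (μ ν : YoungDiagram) : Finset (ℕ × ℕ) :=
  {c ∈ μ.cells | (∃ d ∈ μ.cells \ ν.cells, d.1 = c.1) ∧ ¬ ∃ d ∈ μ.cells \ ν.cells, d.2 = c.2}

/-- `b_μ(c; τ)`. -/
def bFactor {K : Type*} [Field K] (μ : YoungDiagram) (τ : K) (c : ℕ × ℕ) : K :=
  ((arm μ c : K) + τ * ((leg μ c : K) + 1)) / ((arm μ c : K) + τ * (leg μ c : K) + 1)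

/-- The weight `Φ_T(τ)`; the factor with index `i` is the one for `λ^(i) \ λ^(i+1)`. -/
def ReverseTableau.weight {K : Type*} [Field K] {lam : YoungDiagram} {r : ℕ}
    (T : ReverseTableau lam r) (τ : K) : K :=
  ∏ i ∈ Finset.range r, ∏ c ∈ rowNotCol (T.sub i) (T.sub (i + 1)),
    bFactor (T.sub (i + 1)) τ c / bFactor (T.sub i) τ c

/-- The Okounkov polynomial `P_λ(x; τ; α)` of type `BC_r` in the variables `x_1, …, x_r`. -/
def okounkovPoly {K : Type*} [Field K] (r : ℕ) (lam : YoungDiagram) (τ α : K) :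
    MvPolynomial (Fin r) K :=
  ∑ T : ReverseTableau lam r, C (T.weight τ) *
    ∏ c : lam.cells, (X (T.entry c) ^ 2 -
      C (((c.1.2 : K) + τ * ((r : K) - ((T.entry c : ℕ) + 1 : K) - (c.1.1 : K)) + α) ^ 2))

/-- `ρ_i = (n - (2i - 1)) / 2` for `i` in `{1, …, r}`. -/
def rho (n : ℕ) {r : ℕ} (i : Fin r) : ℂ := ((n : ℂ) - (2 * (((i : ℕ) : ℂ) + 1) - 1)) / 2

/-- `P_λ(x + ρ; 1; s - (n - 1) / 2)` as a polynomial in `x_1, …, x_r`. -/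
def shiftedOkounkovPoly (n r : ℕ) (s : ℂ) (lam : YoungDiagram) : MvPolynomial (Fin r) ℂ :=
  bind₁ (fun i : Fin r => X i + C (rho n i)) (okounkovPoly r lam 1 (s - ((n : ℂ) - 1) / 2))

/-- The homogeneous part of highest degree of a polynomial. -/
def topHomogeneousPart {σ R : Type*} [CommSemiring R] (p : MvPolynomial σ R) : MvPolynomial σ R :=
  homogeneousComponent p.totalDegree p

/-- Semistandard tableaux of shape `lam` with all entries among the `r` letters `0, …, r - 1`. -/
abbrev BoundedTableau (lam : YoungDiagram) (r : ℕ) : Type :=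
  {T : SemistandardYoungTableau lam // ∀ c ∈ lam.cells, T c.1 c.2 < r}

instance (lam : YoungDiagram) (r : ℕ) : Finite (BoundedTableau lam r) := by
  refine Finite.of_injective
    (fun (T : BoundedTableau lam r) (c : lam.cells) => (⟨T.1 c.1.1 c.1.2, T.2 c.1 c.2⟩ : Fin r)) ?_
  intro T T' h
  refine Subtype.ext (SemistandardYoungTableau.ext fun i j => ?_)
  by_cases hc : (i, j) ∈ lam
  · exact congrArg Fin.val (congrFun h ⟨(i, j), hc⟩)
  · rw [T.1.zeros hc, T'.1.zeros hc]

instance (lam : YoungDiagram) (r : ℕ) : Fintype (BoundedTableau lam r) := Fintype.ofFinite _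

/-- The Schur polynomial `s_λ(x_1, …, x_r)`. -/
def schurPoly (R : Type*) [CommSemiring R] (r : ℕ) (lam : YoungDiagram) : MvPolynomial (Fin r) R :=
  ∑ T : BoundedTableau lam r, ∏ c : lam.cells, X ⟨T.1 c.1.1 c.1.2, T.2 c.1 c.2⟩

/-- The partition `2μ = (2μ_1, 2μ_2, …)` of `2m`. -/
def doublePartition {m : ℕ} (μ : m.Partition) : (2 * m).Partition where
  parts := μ.parts.map (2 * ·)
  parts_pos := by
    intro i hi
    obtain ⟨j, hj, rfl⟩ := Multiset.mem_map.mp hi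
    exact Nat.mul_pos two_pos (μ.parts_pos hj)
  parts_sum := by rw [Multiset.sum_map_mul_left, Multiset.map_id', μ.parts_sum]

end Okounkov

end

/-! At `τ = 1` numerator and denominator of every `bFactor` coincide, so all weights `Φ_T` are `1`.
Each box then contributes a quadratic factor whose shift by `ρ` and subtracted constant affect only
lower degrees. The candidate leading form is thus the sum over reverse tableaux of products of
squared variables (`hasLeadingForm_shiftedOkounkovPoly`).

Complementing entries turns reverse tableaux into semistandard ones at the cost of reversing the
variables, which symmetry of the Schur polynomial absorbs (`isSymmetric_schurPoly`). Symmetry is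
proved with Bender–Knuth involutions, realised as reflections of one level of a Gelfand–Tsetlin
pattern. The candidate is nonzero because `lam` has at most `r` rows, so it is the top homogeneous
part. Squaring the variables is an algebra homomorphism taking `p_μ` to `p_{2μ}`, which gives the
power sum formula. -/

namespace Okounkov

/-! ### Gelfand–Tsetlin patterns and the symmetry of Schur polynomials -/

/-- Gelfand–Tsetlin patterns with top row (the rows of) `lam`: `g k i` is the number of entries
less than `k` in row `i` of the corresponding tableau with entries less than `r`. -/
structure IsPattern (lam : YoungDiagram) (r : ℕ) (g : ℕ → ℕ → ℕ) : Prop where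
  zero : ∀ i, g 0 i = 0
  top : ∀ k i, r ≤ k → g k i = lam.rowLen i
  lower : ∀ k i, g (k + 1) (i + 1) ≤ g k i
  upper : ∀ k i, g k i ≤ g (k + 1) i

theorem IsPattern.mono {lam : YoungDiagram} {r : ℕ} {g : ℕ → ℕ → ℕ} (hg : IsPattern lam r g)
    (i : ℕ) : Monotone fun k => g k i :=
  monotone_nat_of_le_succ fun k => hg.upper k i

theorem IsPattern.le_rowLen {lam : YoungDiagram} {r : ℕ} {g : ℕ → ℕ → ℕ} (hg : IsPattern lam r g)
    (k i : ℕ) : g k i ≤ lam.rowLen i :=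
  (hg.mono i (le_max_left k r)).trans (hg.top _ i (le_max_right k r)).le

/-- The number of entries less than `k` in row `i` of `T`. -/
def entriesBelow {lam : YoungDiagram} (T : SemistandardYoungTableau lam) (k i : ℕ) : ℕ :=
  {j ∈ Finset.range (lam.rowLen i) | T i j < k}.card

theorem entriesBelow_le {lam : YoungDiagram} (T : SemistandardYoungTableau lam) (k i : ℕ) :
    entriesBelow T k i ≤ lam.rowLen i :=
  (Finset.card_filter_le _ _).trans (Finset.card_range _).le

/-- Rows increase weakly, so the entries less than `k` fill an initial segment of the row, whose
length is `entriesBelow T k i`. -/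
theorem lt_entriesBelow_iff {lam : YoungDiagram} (T : SemistandardYoungTableau lam) {k i j : ℕ}
    (hj : j < lam.rowLen i) : j < entriesBelow T k i ↔ T i j < k := by
  have mono : ∀ a b, a ≤ b → b < lam.rowLen i → T i a ≤ T i b := fun a b hab hb =>
    T.row_weak_of_le hab (YoungDiagram.mem_iff_lt_rowLen.2 hb)
  constructor
  · intro h
    by_contra hk
    have : ({j ∈ Finset.range (lam.rowLen i) | T i j < k}) ⊆ Finset.range j := by
      intro a ha
      simp only [Finset.mem_filter, Finset.mem_range] at ha ⊢
      by_contra haj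
      have := mono j a (not_lt.1 haj) ha.1
      omega
    have := Finset.card_le_card this
    rw [Finset.card_range] at this
    unfold entriesBelow at h
    omega
  · intro h
    have : Finset.range (j + 1) ⊆ {j ∈ Finset.range (lam.rowLen i) | T i j < k} := by
      intro a ha
      simp only [Finset.mem_filter, Finset.mem_range] at ha ⊢
      have := mono a j (by omega) hj
      omega
    have := Finset.card_le_card this
    rw [Finset.card_range] at this
    exact this

theorem eq_of_forall_lt_iff {a b N : ℕ} (ha : a ≤ N) (hb : b ≤ N)
    (h : ∀ j < N, j < a ↔ j < b) : a = b := by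
  rcases lt_trichotomy a b with hab | hab | hab
  · exact absurd ((h a (by omega)).2 hab) (lt_irrefl _)
  · exact hab
  · exact absurd ((h b (by omega)).1 hab) (lt_irrefl _)

theorem isPattern_entriesBelow {lam : YoungDiagram} {r : ℕ} (T : BoundedTableau lam r) :
    IsPattern lam r (entriesBelow T.1) where
  zero i := by simp [entriesBelow]
  top k i hk := by
    refine eq_of_forall_lt_iff (entriesBelow_le _ _ _) le_rfl fun j hj => ?_
    rw [lt_entriesBelow_iff _ hj]
    exact iff_of_true
      ((T.2 (i, j) (YoungDiagram.mem_iff_lt_rowLen.2 hj)).trans_le hk) hj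
  lower k i := by
    -- If interlacing fails, the box of row `i + 1` in column `j = entriesBelow T k i` has entry at
    -- most `k`. Column strictness makes the entry above it less than `k`, whence `j < j`.
    by_contra! h
    set j := entriesBelow T.1 k i with hjdef
    have hj1 : j < lam.rowLen (i + 1) := h.trans_le (entriesBelow_le _ _ _)
    have hj0 : j < lam.rowLen i := hj1.trans_le (lam.rowLen_anti _ _ (Nat.le_succ i))
    have h1 := (lt_entriesBelow_iff _ hj1).1 h
    have h2 := T.1.col_strict (Nat.lt_add_one i) (YoungDiagram.mem_iff_lt_rowLen.2 hj1)
    have h3 := (lt_entriesBelow_iff T.1 (k := k) hj0).2 (by omega)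
    omega
  upper k i := by
    refine Finset.card_le_card fun a ha => ?_
    simp only [Finset.mem_filter, Finset.mem_range] at ha ⊢
    omega

/-- The tableau of a Gelfand–Tsetlin pattern. -/
def IsPattern.toTableau {lam : YoungDiagram} {r : ℕ} {g : ℕ → ℕ → ℕ} (hg : IsPattern lam r g) :
    SemistandardYoungTableau lam where
  entry i j := if (i, j) ∈ lam then {k ∈ Finset.range r | g (k + 1) i ≤ j}.card else 0
  row_weak' := by
    intro i j1 j2 hj h2
    have h1 : (i, j1) ∈ lam := lam.up_left_mem le_rfl hj.le h2
    rw [if_pos h1, if_pos h2]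
    refine Finset.card_le_card fun a ha => ?_
    simp only [Finset.mem_filter, Finset.mem_range] at ha ⊢
    omega
  col_strict' := by
    intro i1 i2 j hi h2
    have h1 : (i1, j) ∈ lam := lam.up_left_mem hi.le le_rfl h2
    rw [if_pos h1, if_pos h2]
    have anti : ∀ k, Antitone (g k) := fun k =>
      antitone_nat_of_succ_le fun i => (hg.upper k (i + 1)).trans (hg.lower k i)
    have step : ∀ k, g (k + 1) i2 ≤ g k i1 := fun k =>
      (anti (k + 1) (Nat.succ_le_of_lt hi)).trans (hg.lower k i1)
    have hr : 0 < r := by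
      rcases Nat.eq_zero_or_pos r with rfl | hr
      · have := YoungDiagram.mem_iff_lt_rowLen.1 h1
        rw [← hg.top 0 i1 le_rfl, hg.zero] at this
        omega
      · exact hr
    -- Strictness comes from a shift: raising the levels counted for row `i1` by one gives levels
    -- counted for row `i2`, and level `0` is an extra one since `g 1 i2 ≤ g 0 i1 = 0`.
    have key : insert 0 ({k ∈ Finset.range r | g (k + 1) i1 ≤ j}.image (· + 1)) ⊆
        {k ∈ Finset.range r | g (k + 1) i2 ≤ j} := by
      intro a ha
      simp only [Finset.mem_insert, Finset.mem_image, Finset.mem_filter, Finset.mem_range] at ha ⊢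
      rcases ha with rfl | ⟨b, ⟨hb, hbj⟩, rfl⟩
      · have := step 0
        rw [hg.zero] at this
        exact ⟨hr, by omega⟩
      · refine ⟨?_, (step _).trans hbj⟩
        by_contra hbr
        have h := YoungDiagram.mem_iff_lt_rowLen.1 h1
        rw [← hg.top (b + 1) i1 (by omega)] at h
        omega
    have hc := Finset.card_le_card key
    rw [Finset.card_insert_of_notMem (by simp),
      Finset.card_image_of_injective _ (add_left_injective 1)] at hc
    omega
  zeros' h := if_neg h

/-- By monotonicity in the level, the levels counted by the entry form an initial segment of `range
r`, so the entry is its length. -/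
theorem IsPattern.toTableau_lt_iff {lam : YoungDiagram} {r : ℕ} {g : ℕ → ℕ → ℕ}
    (hg : IsPattern lam r g) {i j : ℕ} (hj : j < lam.rowLen i) (k : ℕ) :
    hg.toTableau i j < k ↔ j < g k i := by
  have hT : hg.toTableau i j = {k ∈ Finset.range r | g (k + 1) i ≤ j}.card :=
    if_pos (YoungDiagram.mem_iff_lt_rowLen.2 hj)
  rw [hT]
  constructor
  · intro h
    by_contra hk
    have hkr : k < r := by
      by_contra hkr
      rw [hg.top k i (by omega)] at hk
      exact hk hj
    have : Finset.range k ⊆ {k ∈ Finset.range r | g (k + 1) i ≤ j} := by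
      intro a ha
      simp only [Finset.mem_filter, Finset.mem_range] at ha ⊢
      have : g (a + 1) i ≤ g k i := hg.mono i (Nat.succ_le_of_lt ha)
      omega
    have := Finset.card_le_card this
    rw [Finset.card_range] at this
    omega
  · intro h
    have hk : 0 < k := by
      rcases Nat.eq_zero_or_pos k with rfl | hk
      · rw [hg.zero] at h
        omega
      · exact hk
    have : {k ∈ Finset.range r | g (k + 1) i ≤ j} ⊆ Finset.range (k - 1) := by
      intro a ha
      simp only [Finset.mem_filter, Finset.mem_range] at ha ⊢
      by_contra hak
      have : g k i ≤ g (a + 1) i := hg.mono i (by omega)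
      omega
    have := Finset.card_le_card this
    rw [Finset.card_range] at this
    omega

theorem IsPattern.toTableau_bounded {lam : YoungDiagram} {r : ℕ} {g : ℕ → ℕ → ℕ}
    (hg : IsPattern lam r g) : ∀ c ∈ lam.cells, hg.toTableau c.1 c.2 < r := by
  rintro ⟨i, j⟩ hc
  have hj := YoungDiagram.mem_iff_lt_rowLen.1 ((YoungDiagram.mem_cells _).1 hc)
  rw [hg.toTableau_lt_iff hj, hg.top r i le_rfl]
  exact hj

theorem IsPattern.entriesBelow_toTableau {lam : YoungDiagram} {r : ℕ} {g : ℕ → ℕ → ℕ}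
    (hg : IsPattern lam r g) : entriesBelow hg.toTableau = g := by
  funext k i
  refine eq_of_forall_lt_iff (entriesBelow_le _ _ _) (hg.le_rowLen k i) fun j hj => ?_
  rw [lt_entriesBelow_iff _ hj, hg.toTableau_lt_iff hj]

theorem entriesBelow_injective {lam : YoungDiagram} {T T' : SemistandardYoungTableau lam}
    (h : entriesBelow T = entriesBelow T') : T = T' := by
  ext i j
  by_cases hc : (i, j) ∈ lam
  · have hj := YoungDiagram.mem_iff_lt_rowLen.1 hc
    refine eq_of_forall_gt_iff fun k => ?_
    rw [← lt_entriesBelow_iff T hj, ← lt_entriesBelow_iff T' hj, h]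
  · rw [T.zeros hc, T'.zeros hc]

/-- The upper bound for the `i`-th part at level `a + 1` of a pattern, given the levels `a` and
`a + 2`. -/
def toggleUpper (g : ℕ → ℕ → ℕ) (a : ℕ) : ℕ → ℕ
  | 0 => g (a + 2) 0
  | i + 1 => min (g (a + 2) (i + 1)) (g a i)

/-- The lower bound for the `i`-th part at level `a + 1` of a pattern, given the levels `a` and
`a + 2`. -/
def toggleLower (g : ℕ → ℕ → ℕ) (a i : ℕ) : ℕ := max (g a i) (g (a + 2) (i + 1))

/-- Bender–Knuth toggle at level `a + 1`: every part at that level is reflected in the interval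
allowed by the two neighbouring levels. -/
def toggle (a : ℕ) (g : ℕ → ℕ → ℕ) : ℕ → ℕ → ℕ :=
  Function.update g (a + 1) fun i => toggleLower g a i + toggleUpper g a i - g (a + 1) i

theorem toggle_self (a : ℕ) (g : ℕ → ℕ → ℕ) (i : ℕ) :
    toggle a g (a + 1) i = toggleLower g a i + toggleUpper g a i - g (a + 1) i := by
  simp [toggle]

theorem toggle_of_ne {a k : ℕ} (h : k ≠ a + 1) (g : ℕ → ℕ → ℕ) : toggle a g k = g k := by
  simp [toggle, h]

theorem IsPattern.toggleLower_le {lam : YoungDiagram} {r : ℕ} {g : ℕ → ℕ → ℕ}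
    (hg : IsPattern lam r g) (a i : ℕ) : toggleLower g a i ≤ g (a + 1) i :=
  max_le (hg.upper a i) (hg.lower (a + 1) i)

theorem IsPattern.le_toggleUpper {lam : YoungDiagram} {r : ℕ} {g : ℕ → ℕ → ℕ}
    (hg : IsPattern lam r g) (a i : ℕ) : g (a + 1) i ≤ toggleUpper g a i := by
  cases i with
  | zero => exact hg.upper (a + 1) 0
  | succ i => exact le_min (hg.upper (a + 1) (i + 1)) (hg.lower a i)

theorem toggleUpper_le (g : ℕ → ℕ → ℕ) (a i : ℕ) : toggleUpper g a i ≤ g (a + 2) i := by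
  cases i with
  | zero => exact le_rfl
  | succ i => exact min_le_left _ _

/-- The two bounds encode exactly the inequalities involving level `a + 1`, and a reflection stays
between them. The condition `a + 1 < r` keeps the fixed top levels untouched. -/
theorem IsPattern.toggle {lam : YoungDiagram} {r a : ℕ} {g : ℕ → ℕ → ℕ}
    (hg : IsPattern lam r g) (ha : a + 1 < r) : IsPattern lam r (toggle a g) where
  zero i := by rw [toggle_of_ne (by omega), hg.zero]
  top k i hk := by rw [toggle_of_ne (by omega), hg.top k i hk]
  lower k i := by
    rcases eq_or_ne k a with rfl | h1
    · rw [toggle_self, toggle_of_ne (by omega)]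
      have h1 := hg.toggleLower_le k (i + 1)
      have h2 : toggleUpper g k (i + 1) ≤ g k i := min_le_right _ _
      omega
    · rcases eq_or_ne k (a + 1) with rfl | h2
      · rw [toggle_self, toggle_of_ne (by omega)]
        have h1 := hg.le_toggleUpper a i
        have h2 : g (a + 1 + 1) (i + 1) ≤ toggleLower g a i := le_max_right _ _
        omega
      · rw [toggle_of_ne (by omega), toggle_of_ne h2]
        exact hg.lower k i
  upper k i := by
    rcases eq_or_ne k a with rfl | h1
    · rw [toggle_self, toggle_of_ne (by omega)]
      have h1 := hg.le_toggleUpper k i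
      have h2 : g k i ≤ toggleLower g k i := le_max_left _ _
      omega
    · rcases eq_or_ne k (a + 1) with rfl | h2
      · rw [toggle_self, toggle_of_ne (by omega)]
        have h1 := hg.toggleLower_le a i
        have h2 : toggleUpper g a i ≤ g (a + 1 + 1) i := toggleUpper_le g a i
        omega
      · rw [toggle_of_ne h2, toggle_of_ne (show k + 1 ≠ a + 1 by omega)]
        exact hg.upper k i

/-- The bounds depend only on levels `a` and `a + 2`, which the toggle fixes, so both reflections
use the same interval. -/
theorem IsPattern.toggle_toggle {lam : YoungDiagram} {r : ℕ} {g : ℕ → ℕ → ℕ}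
    (hg : IsPattern lam r g) (a : ℕ) : Okounkov.toggle a (Okounkov.toggle a g) = g := by
  have h0 : Okounkov.toggle a g a = g a := toggle_of_ne (by omega) g
  have h2 : Okounkov.toggle a g (a + 2) = g (a + 2) := toggle_of_ne (by omega) g
  funext k i
  rcases eq_or_ne k (a + 1) with rfl | h
  · have hL : toggleLower (Okounkov.toggle a g) a i = toggleLower g a i := by
      simp only [toggleLower, h0, h2]
    have hU : toggleUpper (Okounkov.toggle a g) a i = toggleUpper g a i := by
      cases i <;> simp only [toggleUpper, h0, h2]
    rw [toggle_self, toggle_self, hL, hU]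
    have h3 := hg.toggleLower_le a i
    have h4 := hg.le_toggleUpper a i
    omega
  · rw [toggle_of_ne h, toggle_of_ne h]

theorem sum_toggleLower_add_toggleUpper (g : ℕ → ℕ → ℕ) (a M : ℕ) :
    ∑ i ∈ Finset.range M, (toggleLower g a i + toggleUpper g a i) + toggleUpper g a M =
      ∑ i ∈ Finset.range M, (g a i + g (a + 2) i) + g (a + 2) M := by
  induction M with
  | zero => simp [toggleUpper]
  | succ M ih =>
    -- The lower bound at `M` and the upper bound at `M + 1` are the max and min of the same two
    -- numbers.
    have h : toggleLower g a M + toggleUpper g a (M + 1) = g a M + g (a + 2) (M + 1) := by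
      simp only [toggleLower, toggleUpper]
      omega
    rw [Finset.sum_range_succ, Finset.sum_range_succ]
    omega

/-- An empty row `M` kills the boundary terms. The size of level `a + 1` is thus reflected between
the sizes of its neighbours, which exchanges the two successive differences. -/
theorem IsPattern.sum_toggle {lam : YoungDiagram} {r : ℕ} {g : ℕ → ℕ → ℕ}
    (hg : IsPattern lam r g) (a : ℕ) {M : ℕ} (hM : lam.rowLen M = 0) :
    ∑ i ∈ Finset.range M, Okounkov.toggle a g (a + 1) i + ∑ i ∈ Finset.range M, g (a + 1) i =
      ∑ i ∈ Finset.range M, g a i + ∑ i ∈ Finset.range M, g (a + 2) i := by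
  have h := sum_toggleLower_add_toggleUpper g a M
  have h1 := hg.le_rowLen (a + 2) M
  have h2 := toggleUpper_le g a M
  rw [← Finset.sum_add_distrib, ← Finset.sum_add_distrib]
  have h3 : ∑ i ∈ Finset.range M, (Okounkov.toggle a g (a + 1) i + g (a + 1) i) =
      ∑ i ∈ Finset.range M, (toggleLower g a i + toggleUpper g a i) := by
    refine Finset.sum_congr rfl fun i _ => ?_
    rw [toggle_self]
    have h3 := hg.toggleLower_le a i
    have h4 := hg.le_toggleUpper a i
    omega
  omega

/-- The Bender–Knuth involution exchanging the numbers of entries `a` and `a + 1`. -/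
def benderKnuth {lam : YoungDiagram} {r a : ℕ} (ha : a + 1 < r) (T : BoundedTableau lam r) :
    BoundedTableau lam r :=
  ⟨((isPattern_entriesBelow T).toggle ha).toTableau,
    ((isPattern_entriesBelow T).toggle ha).toTableau_bounded⟩

theorem entriesBelow_benderKnuth {lam : YoungDiagram} {r a : ℕ} (ha : a + 1 < r)
    (T : BoundedTableau lam r) :
    entriesBelow (benderKnuth ha T).1 = toggle a (entriesBelow T.1) :=
  IsPattern.entriesBelow_toTableau ((isPattern_entriesBelow T).toggle ha)

theorem benderKnuth_involutive {lam : YoungDiagram} {r a : ℕ} (ha : a + 1 < r) :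
    Function.Involutive (benderKnuth (lam := lam) ha) := fun T =>
  Subtype.ext <| entriesBelow_injective <| by
    rw [entriesBelow_benderKnuth, entriesBelow_benderKnuth,
      (isPattern_entriesBelow T).toggle_toggle]

/-- The number of entries of `T` equal to `k`. -/
def content {lam : YoungDiagram} (T : SemistandardYoungTableau lam) (k : ℕ) : ℕ :=
  {c ∈ lam.cells | T c.1 c.2 = k}.card

theorem rowLen_colLen_zero (lam : YoungDiagram) : lam.rowLen (lam.colLen 0) = 0 := by
  by_contra h
  have h1 := YoungDiagram.mem_iff_lt_rowLen.2 (Nat.pos_of_ne_zero h)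
  exact lt_irrefl _ (YoungDiagram.mem_iff_lt_colLen.1 h1)

theorem card_entries_lt {lam : YoungDiagram} (T : SemistandardYoungTableau lam) (k : ℕ) :
    {c ∈ lam.cells | T c.1 c.2 < k}.card =
      ∑ i ∈ Finset.range (lam.colLen 0), entriesBelow T k i := by
  rw [Finset.card_eq_sum_card_fiberwise (f := Prod.fst) (t := Finset.range (lam.colLen 0))]
  · refine Finset.sum_congr rfl fun i _ => ?_
    refine Finset.card_nbij' Prod.snd (fun j => (i, j)) ?_ ?_ ?_ ?_
    · rintro ⟨i', j⟩ h
      simp only [Finset.coe_filter, Finset.mem_filter, Set.mem_ofPred_eq, Finset.mem_range,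
        YoungDiagram.mem_cells] at h ⊢
      obtain ⟨⟨h1, h2⟩, rfl⟩ := h
      exact ⟨YoungDiagram.mem_iff_lt_rowLen.1 h1, h2⟩
    · intro j h
      simp only [Finset.coe_filter, Finset.mem_filter, Set.mem_ofPred_eq, Finset.mem_range,
        YoungDiagram.mem_cells] at h ⊢
      exact ⟨⟨YoungDiagram.mem_iff_lt_rowLen.2 h.1, h.2⟩, trivial⟩
    · rintro ⟨i', j⟩ h
      simp only [Finset.coe_filter, Finset.mem_filter, Set.mem_ofPred_eq] at h
      rw [h.2]
    · intro j _
      rfl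
  · rintro ⟨i, j⟩ h
    simp only [Finset.coe_filter, Set.mem_ofPred_eq, YoungDiagram.mem_cells] at h
    simp only [Finset.coe_range, Set.mem_Iio]
    exact YoungDiagram.mem_iff_lt_colLen.1 (lam.up_left_mem le_rfl (Nat.zero_le j) h.1)

theorem sum_entriesBelow_add_content {lam : YoungDiagram} (T : SemistandardYoungTableau lam)
    (k : ℕ) : ∑ i ∈ Finset.range (lam.colLen 0), entriesBelow T k i + content T k =
      ∑ i ∈ Finset.range (lam.colLen 0), entriesBelow T (k + 1) i := by
  rw [← card_entries_lt, ← card_entries_lt, content, ← Finset.card_union_of_disjoint]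
  · congr 1
    ext c
    simp only [Finset.mem_union, Finset.mem_filter]
    rw [← and_or_left, ← Nat.lt_succ_iff_lt_or_eq]
  · refine Finset.disjoint_filter.2 fun c _ h => ?_
    omega

/-- Contents are differences of successive level sizes, so this is `IsPattern.sum_toggle` read off
level by level. -/
theorem content_benderKnuth {lam : YoungDiagram} {r a : ℕ} (ha : a + 1 < r)
    (T : BoundedTableau lam r) (k : ℕ) :
    content (benderKnuth ha T).1 k = content T.1 (Equiv.swap a (a + 1) k) := by
  have hsum := (isPattern_entriesBelow T).sum_toggle a (rowLen_colLen_zero lam)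
  have hT := sum_entriesBelow_add_content T.1
  have hB := sum_entriesBelow_add_content (benderKnuth ha T).1
  have hne : ∀ m, m ≠ a + 1 → toggle a (entriesBelow T.1) m = entriesBelow T.1 m :=
    fun m hm => toggle_of_ne hm _
  rw [entriesBelow_benderKnuth] at hB
  rcases eq_or_ne k a with rfl | h1
  · rw [Equiv.swap_apply_left]
    have h1 := hB k
    have h2 := hT k
    have h3 := hT (k + 1)
    rw [hne k (by omega)] at h1
    rw [show k + 1 + 1 = k + 2 from rfl] at h3
    omega
  · rcases eq_or_ne k (a + 1) with rfl | h2
    · rw [Equiv.swap_apply_right]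
      have h1 := hB (a + 1)
      have h2 := hT a
      rw [hne (a + 1 + 1) (by omega), show a + 1 + 1 = a + 2 from rfl] at h1
      omega
    · rw [Equiv.swap_apply_of_ne_of_ne h1 h2]
      have h3 := hB k
      have h4 := hT k
      rw [hne k h2, hne (k + 1) (by omega)] at h3
      omega

theorem prod_entries_eq_prod_pow_content {lam : YoungDiagram} {r : ℕ} {M : Type*} [CommMonoid M]
    (T : BoundedTableau lam r) (x : Fin r → M) :
    ∏ c : lam.cells, x ⟨T.1 c.1.1 c.1.2, T.2 c.1 c.2⟩ = ∏ k : Fin r, x k ^ content T.1 k := by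
  rw [← Finset.prod_fiberwise (s := Finset.univ)
    (g := fun c : lam.cells => (⟨T.1 c.1.1 c.1.2, T.2 c.1 c.2⟩ : Fin r))]
  refine Finset.prod_congr rfl fun k _ => ?_
  rw [Finset.prod_congr rfl (g := fun _ => x k)
    fun c hc => congrArg x (Finset.mem_filter.1 hc).2, Finset.prod_const]
  congr 1
  refine Finset.card_bij (fun c _ => c.1) ?_ (fun _ _ _ _ h => Subtype.ext h) ?_
  · intro c hc
    exact Finset.mem_filter.2 ⟨c.2, congrArg Fin.val (Finset.mem_filter.1 hc).2⟩
  · intro c hc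
    obtain ⟨h1, h2⟩ := Finset.mem_filter.1 hc
    exact ⟨⟨c, h1⟩, Finset.mem_filter.2 ⟨Finset.mem_univ _, Fin.ext h2⟩, rfl⟩

theorem rename_swap_schurPoly (R : Type*) [CommSemiring R] (m : ℕ) (lam : YoungDiagram)
    (a : Fin m) :
    rename (Equiv.swap a.castSucc a.succ) (schurPoly R (m + 1) lam) = schurPoly R (m + 1) lam := by
  have ha : (a : ℕ) + 1 < m + 1 := by omega
  have hswap : ∀ k : Fin (m + 1), ((Equiv.swap a.castSucc a.succ k : Fin (m + 1)) : ℕ) =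
      Equiv.swap (a : ℕ) (a + 1) k := by
    intro k
    simp only [Equiv.swap_apply_def, Fin.ext_iff, Fin.val_castSucc, Fin.val_succ]
    split_ifs <;> rfl
  rw [schurPoly, map_sum]
  refine Fintype.sum_equiv (benderKnuth_involutive ha).toPerm _ _ fun T => ?_
  rw [map_prod]
  simp only [rename_X, Function.Involutive.coe_toPerm]
  rw [prod_entries_eq_prod_pow_content T fun k =>
      (X (Equiv.swap a.castSucc a.succ k) : MvPolynomial (Fin (m + 1)) R),
    prod_entries_eq_prod_pow_content (benderKnuth ha T) (X : _ → MvPolynomial (Fin (m + 1)) R)]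
  refine Fintype.prod_equiv (Equiv.swap a.castSucc a.succ) _ _ fun k => ?_
  rw [content_benderKnuth, hswap, Equiv.swap_apply_self]

/-- Schur polynomials are symmetric. -/
theorem isSymmetric_schurPoly (R : Type*) [CommSemiring R] (r : ℕ) (lam : YoungDiagram) :
    (schurPoly R r lam).IsSymmetric := by
  cases r with
  | zero =>
    intro e
    rw [Subsingleton.elim e (Equiv.refl _)]
    simp
  | succ m =>
    intro e
    -- Adjacent transpositions generate the symmetric group, so invariance under each of them
    -- suffices.
    have he : e ∈ Submonoid.closure
        (Set.range fun i : Fin m => Equiv.swap i.castSucc i.succ) := by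
      rw [Equiv.Perm.mclosure_swap_castSucc_succ]
      trivial
    induction he using Submonoid.closure_induction with
    | mem e h =>
      obtain ⟨a, rfl⟩ := h
      exact rename_swap_schurPoly R m lam a
    | one => simp
    | mul e f _ _ h1 h2 =>
      rw [Equiv.Perm.coe_mul, ← rename_rename, h2, h1]

end Okounkov

namespace Okounkov

/-! ### Top homogeneous parts -/

section TopPart

variable {σ R : Type*} [CommRing R]

/-- All monomials of `p` have degree less than `d`. -/
def DegreeLT (d : ℕ) (p : MvPolynomial σ R) : Prop := ∀ m ∈ p.support, m.degree < d

theorem DegreeLT.zero (d : ℕ) : DegreeLT d (0 : MvPolynomial σ R) := by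
  simp [DegreeLT]

theorem DegreeLT.mono {d e : ℕ} (h : d ≤ e) {p : MvPolynomial σ R} (hp : DegreeLT d p) :
    DegreeLT e p := fun m hm => (hp m hm).trans_le h

theorem DegreeLT.add {d : ℕ} {p q : MvPolynomial σ R} (hp : DegreeLT d p) (hq : DegreeLT d q) :
    DegreeLT d (p + q) := by
  classical
  intro m hm
  rcases Finset.mem_union.1 (support_add hm) with h | h
  exacts [hp m h, hq m h]

theorem DegreeLT.mul {d e : ℕ} {p q : MvPolynomial σ R} (hp : DegreeLT d p)
    (hq : DegreeLT (e + 1) q) : DegreeLT (d + e) (p * q) := by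
  classical
  intro m hm
  obtain ⟨a, ha, b, hb, rfl⟩ := Finset.mem_add.1 (support_mul _ _ hm)
  rw [map_add]
  have := hp a ha
  have := hq b hb
  omega

theorem degreeLT_of_isHomogeneous {d : ℕ} {p : MvPolynomial σ R} (hp : p.IsHomogeneous d) :
    DegreeLT (d + 1) p := fun m hm => by
  have : m.degree = d := by
    by_contra h
    exact mem_support_iff.1 hm (hp.coeff_eq_zero h)
  omega

/-- `p` is the sum of the homogeneous polynomial `h` of degree `d` and of terms of lower degree. -/
def HasLeadingForm (d : ℕ) (p h : MvPolynomial σ R) : Prop :=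
  h.IsHomogeneous d ∧ DegreeLT d (p - h)

theorem HasLeadingForm.degreeLT {d : ℕ} {p h : MvPolynomial σ R} (hp : HasLeadingForm d p h) :
    DegreeLT (d + 1) p := by
  have := (hp.2.mono (Nat.le_succ d)).add (degreeLT_of_isHomogeneous hp.1)
  rwa [sub_add_cancel] at this

theorem HasLeadingForm.mul {d e : ℕ} {p h q k : MvPolynomial σ R} (hp : HasLeadingForm d p h)
    (hq : HasLeadingForm e q k) : HasLeadingForm (d + e) (p * q) (h * k) := by
  refine ⟨hp.1.mul hq.1, ?_⟩
  have h1 := hp.2.mul hq.degreeLT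
  have h2 := hq.2.mul (degreeLT_of_isHomogeneous hp.1)
  rw [add_comm e d] at h2
  -- Here `p * q - h * k = (p - h) * q + (q - k) * h`.
  convert h1.add h2 using 1
  ring

theorem HasLeadingForm.sum {ι : Type*} {s : Finset ι} {d : ℕ} {p h : ι → MvPolynomial σ R}
    (H : ∀ i ∈ s, HasLeadingForm d (p i) (h i)) :
    HasLeadingForm d (∑ i ∈ s, p i) (∑ i ∈ s, h i) := by
  refine ⟨IsHomogeneous.sum _ _ _ fun i hi => (H i hi).1, ?_⟩
  rw [← Finset.sum_sub_distrib]
  exact Finset.sum_induction _ (DegreeLT d) (fun _ _ => DegreeLT.add) (DegreeLT.zero d)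
    fun i hi => (H i hi).2

theorem HasLeadingForm.prod {ι : Type*} {s : Finset ι} {d : ℕ} {p h : ι → MvPolynomial σ R}
    (H : ∀ i ∈ s, HasLeadingForm d (p i) (h i)) :
    HasLeadingForm (s.card * d) (∏ i ∈ s, p i) (∏ i ∈ s, h i) := by
  classical
  induction s using Finset.induction_on with
  | empty =>
    simp only [Finset.prod_empty, Finset.card_empty, zero_mul]
    exact ⟨isHomogeneous_one _ _, by rw [sub_self]; exact DegreeLT.zero _⟩
  | insert a s ha ih =>
    rw [Finset.prod_insert ha, Finset.prod_insert ha, Finset.card_insert_of_notMem ha, add_mul,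
      one_mul, add_comm]
    exact (H a (Finset.mem_insert_self a s)).mul
      (ih fun i hi => H i (Finset.mem_insert_of_mem hi))

/-- The remainder is `2 * a * X i + (a ^ 2 - b)`, of degree at most one. -/
theorem hasLeadingForm_sq_sub (i : σ) (a b : R) :
    HasLeadingForm 2 ((X i + C a) ^ 2 - C b : MvPolynomial σ R) (X i ^ 2) := by
  refine ⟨isHomogeneous_X_pow i 2, ?_⟩
  have h1 : DegreeLT 2 (C (2 * a) * X i : MvPolynomial σ R) := by
    refine degreeLT_of_isHomogeneous ?_
    simpa using (isHomogeneous_C σ (2 * a)).mul (isHomogeneous_X R i)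
  have h2 : DegreeLT 2 (C (a ^ 2 - b) : MvPolynomial σ R) :=
    (degreeLT_of_isHomogeneous (isHomogeneous_C σ _)).mono one_le_two
  convert h1.add h2 using 1
  simp only [map_mul, map_sub, map_pow, map_ofNat]
  ring

/-- Nonvanishing of `h` is what forces the total degree of `p` to be `d`; with `h = 0` it could be
smaller. -/
theorem HasLeadingForm.topHomogeneousPart_eq {d : ℕ} {p h : MvPolynomial σ R}
    (hp : HasLeadingForm d p h) (h0 : h ≠ 0) : topHomogeneousPart p = h := by
  have hcoeff : ∀ m : σ →₀ ℕ, d ≤ m.degree → coeff m p = coeff m h := by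
    intro m hm
    by_contra hne
    have : m ∈ (p - h).support := by
      rw [mem_support_iff, coeff_sub]
      exact sub_ne_zero.2 hne
    exact absurd (hp.2 m this) (not_lt.2 hm)
  have hdeg : p.totalDegree = d := by
    refine le_antisymm ?_ ?_
    · refine Finset.sup_le fun m hm => Nat.lt_succ_iff.1 ?_
      exact hp.degreeLT m hm
    · obtain ⟨m, hm⟩ := support_nonempty.2 h0
      have hmd : m.degree = d := by
        by_contra hne
        exact mem_support_iff.1 hm (hp.1.coeff_eq_zero hne)
      rw [← hmd]
      refine le_totalDegree (s := m) ?_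
      rw [mem_support_iff, hcoeff m hmd.ge]
      exact mem_support_iff.1 hm
  ext m
  rw [topHomogeneousPart, coeff_homogeneousComponent, hdeg]
  split_ifs with hm
  · exact hcoeff m hm.ge
  · exact (hp.1.coeff_eq_zero hm).symm

end TopPart

/-! ### The Okounkov polynomial at `τ = 1` -/

theorem bFactor_one {K : Type*} [Field K] [CharZero K] (μ : YoungDiagram) (c : ℕ × ℕ) :
    bFactor μ (1 : K) c = 1 := by
  have h : ((arm μ c : K) + (leg μ c : K) + 1) ≠ 0 := by
    exact_mod_cast Nat.succ_ne_zero (arm μ c + leg μ c)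
  rw [bFactor, one_mul, one_mul, ← add_assoc, div_self h]

theorem ReverseTableau.weight_one {K : Type*} [Field K] [CharZero K] {lam : YoungDiagram} {r : ℕ}
    (T : ReverseTableau lam r) : T.weight (1 : K) = 1 := by
  simp [ReverseTableau.weight, bFactor_one]

theorem hasLeadingForm_shiftedOkounkovPoly (n r : ℕ) (s : ℂ) (lam : YoungDiagram) :
    HasLeadingForm (lam.card * 2) (shiftedOkounkovPoly n r s lam)
      (∑ T : ReverseTableau lam r, ∏ c : lam.cells, X (T.entry c) ^ 2) := by
  have hcard : lam.card = (Finset.univ : Finset lam.cells).card := by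
    rw [Finset.card_univ, Fintype.card_coe]
  rw [shiftedOkounkovPoly, okounkovPoly, map_sum, hcard]
  refine HasLeadingForm.sum fun T _ => ?_
  rw [T.weight_one, C_1, one_mul, map_prod]
  refine HasLeadingForm.prod fun c _ => ?_
  rw [map_sub, map_pow, bind₁_X_right, bind₁_C_right]
  exact hasLeadingForm_sq_sub _ _ _

/-! ### Reverse tableaux and semistandard tableaux -/

/-- Replacing every entry `t` by `r - 1 - t` turns reverse tableaux into semistandard ones. -/
def reverseTableauEquiv (lam : YoungDiagram) (r : ℕ) :
    ReverseTableau lam r ≃ BoundedTableau lam r where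
  toFun T := ⟨{
      entry := fun i j => if h : (i, j) ∈ lam.cells then ((T.entry ⟨(i, j), h⟩).rev : ℕ) else 0
      row_weak' := by
        intro i j1 j2 hj h2
        have h1 : (i, j1) ∈ lam.cells := lam.up_left_mem le_rfl hj.le h2
        rw [dif_pos h1, dif_pos ((YoungDiagram.mem_cells _).2 h2)]
        exact Fin.rev_le_rev.2 (T.row_weak ⟨(i, j1), h1⟩ ⟨(i, j2), h2⟩ rfl hj)
      col_strict' := by
        intro i1 i2 j hi h2
        have h1 : (i1, j) ∈ lam.cells := lam.up_left_mem hi.le le_rfl h2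
        rw [dif_pos h1, dif_pos ((YoungDiagram.mem_cells _).2 h2)]
        exact Fin.rev_lt_rev.2 (T.col_strict ⟨(i1, j), h1⟩ ⟨(i2, j), h2⟩ rfl hi)
      zeros' := fun h => dif_neg h }, by
    intro c hc
    change (if h : (c.1, c.2) ∈ lam.cells then ((T.entry ⟨(c.1, c.2), h⟩).rev : ℕ) else 0) < r
    rw [dif_pos hc]
    exact Fin.is_lt _⟩
  invFun S :=
    { entry := fun c => (⟨S.1 c.1.1 c.1.2, S.2 c.1 c.2⟩ : Fin r).rev
      row_weak := by
        rintro ⟨⟨i, j⟩, hc⟩ ⟨⟨i', j'⟩, hd⟩ h hj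
        obtain rfl : i = i' := h
        exact Fin.rev_le_rev.2 (Fin.le_def.2 (S.1.row_weak hj hd))
      col_strict := by
        rintro ⟨⟨i, j⟩, hc⟩ ⟨⟨i', j'⟩, hd⟩ h hi
        obtain rfl : j = j' := h
        exact Fin.rev_lt_rev.2 (Fin.lt_def.2 (S.1.col_strict hi hd)) }
  left_inv T := by
    refine ReverseTableau.ext (funext fun c => ?_)
    refine (congrArg Fin.rev (Fin.ext ?_)).trans (Fin.rev_rev _)
    exact dif_pos c.2
  right_inv S := by
    refine Subtype.ext (SemistandardYoungTableau.ext fun i j => ?_)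
    by_cases h : (i, j) ∈ lam.cells
    · refine (dif_pos h).trans ?_
      rw [Fin.rev_rev]
    · refine (dif_neg h).trans (S.1.zeros h).symm

theorem reverseTableauEquiv_apply {lam : YoungDiagram} {r : ℕ} (T : ReverseTableau lam r)
    (c : lam.cells) : (⟨(reverseTableauEquiv lam r T).1 c.1.1 c.1.2,
      (reverseTableauEquiv lam r T).2 c.1 c.2⟩ : Fin r) = (T.entry c).rev :=
  Fin.ext (dif_pos c.2)

/-- Complementing entries yields the Schur polynomial in reversed variables; symmetry removes the
reversal. -/
theorem sum_reverseTableau_eq_schurPoly (R : Type*) [CommSemiring R] (r : ℕ) (lam : YoungDiagram) :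
    ∑ T : ReverseTableau lam r, ∏ c : lam.cells, (X (T.entry c) : MvPolynomial (Fin r) R) =
      schurPoly R r lam := by
  rw [← isSymmetric_schurPoly R r lam Fin.revPerm, schurPoly, map_sum]
  refine Fintype.sum_equiv (reverseTableauEquiv lam r) _ _ fun T => ?_
  rw [map_prod]
  refine Finset.prod_congr rfl fun c _ => ?_
  rw [rename_X, reverseTableauEquiv_apply, Fin.revPerm_apply, Fin.rev_rev]

/-! ### Squaring the variables -/

theorem sum_reverseTableau_sq (R : Type*) [CommSemiring R] (r : ℕ) (lam : YoungDiagram) :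
    ∑ T : ReverseTableau lam r, ∏ c : lam.cells, (X (T.entry c) ^ 2 : MvPolynomial (Fin r) R) =
      bind₁ (fun i : Fin r => X i ^ 2) (schurPoly R r lam) := by
  rw [← sum_reverseTableau_eq_schurPoly, map_sum]
  simp only [map_prod, bind₁_X_right]

/-- Evaluating all variables at `1` counts the tableaux. The highest weight tableau, with every
entry equal to its row index, is one of them because there are at most `r` rows; characteristic zero
keeps the count nonzero. -/
theorem bind₁_sq_schurPoly_ne_zero (R : Type*) [CommSemiring R] [CharZero R] (r : ℕ)
    (lam : YoungDiagram) (hlam : lam.colLen 0 ≤ r) :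
    bind₁ (fun i : Fin r => (X i ^ 2 : MvPolynomial (Fin r) R)) (schurPoly R r lam) ≠ 0 := by
  have hT : ∀ c ∈ lam.cells, SemistandardYoungTableau.highestWeight lam c.1 c.2 < r := by
    rintro ⟨i, j⟩ hc
    rw [SemistandardYoungTableau.highestWeight_apply, if_pos ((YoungDiagram.mem_cells _).1 hc)]
    exact (YoungDiagram.mem_iff_lt_colLen.1
      (lam.up_left_mem le_rfl (Nat.zero_le j) hc)).trans_le hlam
  have : Nonempty (BoundedTableau lam r) := ⟨⟨_, hT⟩⟩
  intro h
  have h1 := congrArg (eval fun _ => (1 : R)) h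
  simp only [schurPoly, map_sum, map_prod, bind₁_X_right, map_pow, eval_X, one_pow,
    Finset.prod_const_one, Finset.sum_const, Finset.card_univ, nsmul_eq_mul, mul_one, map_zero,
    Nat.cast_eq_zero] at h1
  exact Fintype.card_ne_zero h1

theorem bind₁_sq_psumPart (R : Type*) [CommSemiring R] (r : ℕ) {m : ℕ} (μ : m.Partition) :
    bind₁ (fun i : Fin r => (X i ^ 2 : MvPolynomial (Fin r) R)) (psumPart (Fin r) R μ) =
      psumPart (Fin r) R (doublePartition μ) := by
  rw [psumPart, psumPart, doublePartition, map_multiset_prod, Multiset.map_map, Multiset.map_map]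
  congr 1
  refine Multiset.map_congr rfl fun k _ => ?_
  simp only [Function.comp_apply, psum, map_sum, map_pow, bind₁_X_right, pow_mul]

end Okounkov

theorem mainTheorem2 (n r : ℕ) (hn : 2 * r ≤ n) (s : ℂ)
    (lam : YoungDiagram) (hlam : lam.colLen 0 ≤ r) :
    Okounkov.topHomogeneousPart (Okounkov.shiftedOkounkovPoly n r s lam) =
        bind₁ (fun i : Fin r => X i ^ 2) (Okounkov.schurPoly ℂ r lam) ∧
      ∀ a : (Σ m : ℕ, m.Partition) →₀ ℂ,
        Okounkov.schurPoly ℂ r lam = a.sum (fun μ c => c • psumPart (Fin r) ℂ μ.2) →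
        Okounkov.topHomogeneousPart (Okounkov.shiftedOkounkovPoly n r s lam) =
          a.sum (fun μ c => c • psumPart (Fin r) ℂ (Okounkov.doublePartition μ.2)) := by
  have key : Okounkov.topHomogeneousPart (Okounkov.shiftedOkounkovPoly n r s lam) =
      bind₁ (fun i : Fin r => X i ^ 2) (Okounkov.schurPoly ℂ r lam) := by
    have h := Okounkov.hasLeadingForm_shiftedOkounkovPoly n r s lam
    rw [Okounkov.sum_reverseTableau_sq] at h
    exact h.topHomogeneousPart_eq (Okounkov.bind₁_sq_schurPoly_ne_zero ℂ r lam hlam)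
  refine ⟨key, fun a ha => ?_⟩
  -- The substitution is linear, so it applies termwise to any given expansion; no uniqueness of
  -- coefficients is needed.
  rw [key, ha, Finsupp.sum, Finsupp.sum, map_sum]
  refine Finset.sum_congr rfl fun μ _ => ?_
  rw [map_smul, Okounkov.bind₁_sq_psumPart]
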